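/- An interval exchange transformation (IET) of $[0,1)$ is a bijection $T:[0,1)\to[0,1)$ for which there are $n\ge 1$, lengths $l_1,\dots,l_n>0$ with $\sum_i l_i=1$ and a permutation $\sigma\in\mathfrak S_n$ such that, for each $i$, $T$ translates the interval $\big[\sum_{j<i}l_j,\ \sum_{j\le i}l_j\big)$ by $\sum_{\sigma(j)<\sigma(i)}l_j-\sum_{j<i}l_j$. Taking the intervals to be the maximal intervals of continuity, i.e. requiring $\sigma(i+1)\ne\sigma(i)+1$ for $1\le i<n$, makes $\lambda(T)=(l_1,\dots,l_n)$ and $\pi(T)=\sigma$ unique. The set of IETs carries the topology of the extended distance $d(S,T)=\|\lambda(S)-\lambda(T)\|_1$ if $\pi(S)=\pi(T)$, and $d(S,T)=\infty$ otherwise. An IET $T$ with $\pi(T)=\sigma\in\mathfrak S_n$ is admissible if there is no $k\in\{1,\dots,n\}$ with $\sigma(k)=k$ and $\sigma(\{1,\dots,k\})=\{1,\dots,k\}$; let $\mathrm{IET}_a([0,1))$ be the set of admissible IETs with the subspace topology. **Theorem.** Let $S$ be any IET of $[0,1)$. There exists a dense open subset $\Omega_a(S)$ of $\mathrm{IET}_a([0,1))$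 such that for every $T\in\Omega_a(S)$ the group $\langle S,T\rangle$ generated by $S$ and $T$ (under composition) is not a free group of rank $2$. -/

import Mathlib

/-- An interval exchange transformation of `[0,1)`: a bijection `toPerm` of `[0,1)` which, for
lengths `len 0, …, len (n-1) > 0` of total length `1` and a permutation `perm`, cuts `[0,1)` into
consecutive half-open intervals with these lengths and moves the `i`-th one by a translation, so
that it becomes the `perm i`-th interval from the left.

The condition `reduced` says that adjacent intervals do not stay adjacent in the same order, so that
the intervals are exactly the maximal intervals of continuity. Hence `n`, `perm` and `len` are
determined by the transformation, see `IET.toPerm_injective`. -/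
structure IET where
  /-- the transformation of `[0,1)` -/
  toPerm : Equiv.Perm (Set.Ico (0 : ℝ) 1)
  /-- the number of intervals of continuity -/
  n : ℕ
  /-- the underlying permutation -/
  perm : Equiv.Perm (Fin n)
  /-- the lengths of the intervals of continuity, from left to right -/
  len : Fin n → ℝ
  len_pos : ∀ i, 0 < len i
  len_sum : ∑ i, len i = 1
  reduced : ∀ i j : Fin n, (j : ℕ) = i + 1 → (perm j : ℕ) ≠ perm i + 1
  toPerm_apply : ∀ (i : Fin n) (x : Set.Ico (0 : ℝ) 1),
    (∑ j with j < i, len j) ≤ (x : ℝ) → (x : ℝ) < (∑ j with j < i, len j) + len i →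
      (toPerm x : ℝ) = x + ((∑ j with perm j < perm i, len j) - (∑ j with j < i, len j))

namespace IET

/-- Two IETs have the same underlying permutation (in particular, the same number of intervals). -/
def SamePerm (S T : IET) : Prop :=
  ∃ h : S.n = T.n, ∀ i, Fin.cast h (S.perm i) = T.perm (Fin.cast h i)

open Classical in
/-- The extended distance on IETs: the `ℓ¹` distance of the length vectors if the underlying
permutations agree, and `∞` otherwise. -/
noncomputable instance : EDist IET where
  edist S T :=
    if h : SamePerm S T then ENNReal.ofReal (∑ i, |S.len i - T.len (Fin.cast h.fst i)|) else ⊤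

theorem edist_def (S T : IET) (h : SamePerm S T) :
    edist S T = ENNReal.ofReal (∑ i, |S.len i - T.len (Fin.cast h.fst i)|) := dif_pos h

theorem edist_eq_top (S T : IET) (h : ¬ SamePerm S T) : edist S T = ⊤ := dif_neg h

theorem SamePerm.symm {S T : IET} (h : SamePerm S T) : SamePerm T S := by
  obtain ⟨_, n, σ, l, _, _, _, _⟩ := S
  obtain ⟨_, m, τ, l', _, _, _, _⟩ := T
  obtain ⟨h, h'⟩ := h
  dsimp only at h h'
  subst h
  exact ⟨rfl, fun i => (h' i).symm⟩

theorem SamePerm.trans {S T U : IET} (h : SamePerm S T) (k : SamePerm T U) : SamePerm S U := by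
  obtain ⟨_, n, σ, l, _, _, _, _⟩ := S
  obtain ⟨_, m, τ, l', _, _, _, _⟩ := T
  obtain ⟨_, p, υ, l'', _, _, _, _⟩ := U
  obtain ⟨h, h'⟩ := h
  obtain ⟨k, k'⟩ := k
  dsimp only at h h' k k'
  subst h k
  exact ⟨rfl, fun i => (h' i).trans (k' i)⟩

theorem edist_le_of_samePerm (S T : IET) (h : SamePerm S T) : edist S T ≤ edist T S := by
  rw [edist_def S T h, edist_def T S h.symm]
  obtain ⟨_, n, σ, l, _, _, _, _⟩ := S
  obtain ⟨_, m, τ, l', _, _, _, _⟩ := T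
  obtain ⟨h, h'⟩ := h
  dsimp only at h h'
  subst h
  refine ENNReal.ofReal_le_ofReal (Finset.sum_le_sum fun i _ => ?_)
  exact (abs_sub_comm _ _).le

theorem edist_triangle_of_samePerm (S T U : IET) (h : SamePerm S T) (k : SamePerm T U) :
    edist S U ≤ edist S T + edist T U := by
  rw [edist_def S T h, edist_def T U k, edist_def S U (h.trans k),
    ← ENNReal.ofReal_add (by positivity) (by positivity)]
  obtain ⟨_, n, σ, l, _, _, _, _⟩ := S
  obtain ⟨_, m, τ, l', _, _, _, _⟩ := T
  obtain ⟨_, p, υ, l'', _, _, _, _⟩ := U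
  obtain ⟨h, h'⟩ := h
  obtain ⟨k, k'⟩ := k
  dsimp only at h h' k k'
  subst h k
  refine ENNReal.ofReal_le_ofReal ?_
  rw [← Finset.sum_add_distrib]
  exact Finset.sum_le_sum fun i _ => abs_sub_le _ _ _

/-- The topology on IETs is the one of the extended distance above. -/
noncomputable instance : PseudoEMetricSpace IET where
  edist_self S := by
    rw [edist_def S S ⟨rfl, fun _ => rfl⟩]
    simp
  edist_comm S T := by
    by_cases h : SamePerm S T
    · exact le_antisymm (edist_le_of_samePerm S T h) (edist_le_of_samePerm T S h.symm)
    · rw [edist_eq_top S T h, edist_eq_top T S fun k => h k.symm]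
  edist_triangle S T U := by
    by_cases h : SamePerm S T
    · by_cases k : SamePerm T U
      · exact edist_triangle_of_samePerm S T U h k
      · simp [edist_eq_top T U k]
    · simp [edist_eq_top S T h]

/-- An IET is admissible when there is no `k` which is fixed by its underlying permutation and for
which the initial segment ending at `k` is invariant. -/
def IsAdmissible (T : IET) : Prop :=
  ¬ ∃ k : Fin T.n, T.perm k = k ∧ T.perm '' Set.Iic k = Set.Iic k

theorem sum_lt_add_le (T : IET) (i : Fin T.n) : ∑ j with j < i, T.len j + T.len i ≤ 1 := by
  rw [← T.len_sum, add_comm, ← Finset.sum_insert (by simp)]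
  exact Finset.sum_le_sum_of_subset_of_nonneg (Finset.subset_univ _) fun j _ _ => (T.len_pos j).le

theorem sum_lt_nonneg (T : IET) (i : Fin T.n) : 0 ≤ ∑ j with j < i, T.len j :=
  Finset.sum_nonneg fun j _ => (T.len_pos j).le

theorem sum_lt_succ (T : IET) (i j : Fin T.n) (h : (j : ℕ) = i + 1) :
    ∑ k with k < j, T.len k = ∑ k with k < i, T.len k + T.len i := by
  rw [add_comm, ← Finset.sum_insert (by simp)]
  congr 1
  ext k
  simp only [Finset.mem_filter, Finset.mem_insert, Finset.mem_univ, true_and, Fin.lt_def,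
    Fin.ext_iff]
  omega

/-- Adjacent intervals have different translation lengths. -/
theorem translation_ne (T : IET) (i j : Fin T.n) (h : (j : ℕ) = i + 1) :
    ∑ k with T.perm k < T.perm j, T.len k - ∑ k with k < j, T.len k ≠
      ∑ k with T.perm k < T.perm i, T.len k - ∑ k with k < i, T.len k := by
  rw [T.sum_lt_succ i j h]
  intro e
  have e' : ∑ k with T.perm k < T.perm j, T.len k =
      ∑ k with T.perm k < T.perm i, T.len k + T.len i := by linarith
  have hi := T.len_pos i
  rcases lt_or_ge (T.perm i) (T.perm j) with hlt | hle
  · obtain ⟨m, hm⟩ := T.perm.surjective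
      (⟨T.perm i + 1, lt_of_le_of_lt (Nat.succ_le_of_lt hlt) (T.perm j).2⟩ : Fin T.n)
    have hm' : (T.perm m : ℕ) = T.perm i + 1 := by rw [hm]
    have hne := T.reduced i j h
    have hmj : T.perm m < T.perm j := by
      rw [Fin.lt_def] at hlt ⊢
      omega
    have hsub : insert m (insert i (Finset.univ.filter fun k => T.perm k < T.perm i)) ⊆
        Finset.univ.filter fun k => T.perm k < T.perm j := by
      intro k hk
      simp only [Finset.mem_insert, Finset.mem_filter, Finset.mem_univ, true_and] at hk ⊢
      rcases hk with rfl | rfl | hk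
      · exact hmj
      · exact hlt
      · exact hk.trans hlt
    have hle := Finset.sum_le_sum_of_subset_of_nonneg hsub fun k _ _ => (T.len_pos k).le
    rw [Finset.sum_insert, Finset.sum_insert (by simp)] at hle
    · have := T.len_pos m
      linarith
    · simp only [Finset.mem_insert, Finset.mem_filter, Finset.mem_univ, true_and, not_or]
      refine ⟨fun e => ?_, fun e => ?_⟩
      · rw [e] at hm'
        omega
      · rw [Fin.lt_def] at e
        omega
  · have hle' : ∑ k with T.perm k < T.perm j, T.len k ≤ ∑ k with T.perm k < T.perm i, T.len k := by
      refine Finset.sum_le_sum_of_subset_of_nonneg (fun k hk => ?_) fun k _ _ => (T.len_pos k).le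
      simp only [Finset.mem_filter, Finset.mem_univ, true_and] at hk ⊢
      exact hk.trans_le hle
    linarith

/-- The left end point of the `i`-th interval, as a point of `[0,1)`. -/
noncomputable def leftPt (T : IET) (i : Fin T.n) : Set.Ico (0 : ℝ) 1 :=
  ⟨∑ j with j < i, T.len j, T.sum_lt_nonneg i,
    by have := T.sum_lt_add_le i; have := T.len_pos i; linarith⟩

theorem toPerm_leftPt (T : IET) (i : Fin T.n) :
    (T.toPerm (T.leftPt i) : ℝ) = ∑ j with T.perm j < T.perm i, T.len j := by
  rw [T.toPerm_apply i _ le_rfl (by simpa [leftPt] using T.len_pos i)]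
  simp [leftPt]

theorem exists_succ_of_lt_one (T : IET) (i : Fin T.n)
    (h : ∑ j with j < i, T.len j + T.len i < 1) : (i : ℕ) + 1 < T.n := by
  by_contra hn
  have : insert i (Finset.univ.filter fun j => j < i) = Finset.univ := by
    ext k
    simp only [Finset.mem_filter, Finset.mem_insert, Finset.mem_univ, true_and, Fin.lt_def,
      Fin.ext_iff, iff_true]
    omega
  rw [add_comm, ← Finset.sum_insert (by simp), this, T.len_sum] at h
  exact lt_irrefl _ h

theorem len_le_of_toPerm_eq (S T : IET) (h : S.toPerm = T.toPerm) (i : Fin S.n) (j : Fin T.n)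
    (hij : ∑ k with k < i, S.len k = ∑ k with k < j, T.len k) : T.len j ≤ S.len i := by
  by_contra! hlt
  have hS := T.sum_lt_add_le j
  have hi := S.exists_succ_of_lt_one i (by linarith)
  have hs := S.sum_lt_succ i ⟨i + 1, hi⟩ rfl
  apply S.translation_ne i ⟨i + 1, hi⟩ rfl
  have e : S.leftPt i = T.leftPt j := Subtype.ext hij
  have h1 := S.toPerm_leftPt ⟨i + 1, hi⟩
  have h2 := S.toPerm_leftPt i
  have h3 := T.toPerm_leftPt j
  have h4 := T.toPerm_apply j (S.leftPt ⟨i + 1, hi⟩)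
    (by have := S.len_pos i; simp only [leftPt]; linarith) (by simp only [leftPt]; linarith)
  rw [← h] at h3 h4
  rw [e, h3] at h2
  rw [h1] at h4
  simp only [leftPt] at h4
  rw [h4, ← h2, hij]
  ring

theorem sum_lt_eq_of_toPerm_eq (S T : IET) (h : S.toPerm = T.toPerm) (k : ℕ) (hS : k < S.n)
    (hT : k < T.n) :
    ∑ j with j < (⟨k, hS⟩ : Fin S.n), S.len j = ∑ j with j < (⟨k, hT⟩ : Fin T.n), T.len j := by
  induction k with
  | zero => simp [Fin.lt_def]
  | succ k ih =>
    have ih := ih (by omega) (by omega)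
    rw [S.sum_lt_succ ⟨k, by omega⟩ ⟨k + 1, hS⟩ rfl, T.sum_lt_succ ⟨k, by omega⟩ ⟨k + 1, hT⟩ rfl,
      ih, le_antisymm (len_le_of_toPerm_eq T S h.symm _ _ ih.symm)
        (len_le_of_toPerm_eq S T h _ _ ih)]

theorem n_le_of_toPerm_eq (S T : IET) (h : S.toPerm = T.toPerm) : S.n ≤ T.n := by
  by_contra! hlt
  have hT0 : T.n ≠ 0 := fun h0 => by
    have : IsEmpty (Fin T.n) := by rw [h0]; infer_instance
    have := T.len_sum
    simp at this
  have e := sum_lt_eq_of_toPerm_eq S T h (T.n - 1) (by omega) (by omega)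
  have hle := len_le_of_toPerm_eq S T h _ _ e
  have h1 := S.sum_lt_succ ⟨T.n - 1, by omega⟩ ⟨T.n, hlt⟩ (by simp; omega)
  have h2 := S.sum_lt_add_le ⟨T.n, hlt⟩
  have h3 := S.len_pos ⟨T.n, hlt⟩
  have h4 := T.exists_succ_of_lt_one ⟨T.n - 1, by omega⟩ (by linarith)
  simp at h4
  omega

theorem sum_perm_lt_iff (T : IET) (i j : Fin T.n) :
    ∑ k with T.perm k < T.perm i, T.len k < ∑ k with T.perm k < T.perm j, T.len k ↔
      T.perm i < T.perm j := by
  have key : ∀ i j, T.perm i ≤ T.perm j →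
      ∑ k with T.perm k < T.perm i, T.len k ≤ ∑ k with T.perm k < T.perm j, T.len k := by
    intro i j hij
    refine Finset.sum_le_sum_of_subset_of_nonneg (fun k hk => ?_) fun k _ _ => (T.len_pos k).le
    simp only [Finset.mem_filter, Finset.mem_univ, true_and] at hk ⊢
    exact hk.trans_le hij
  constructor
  · intro h
    by_contra! h'
    exact absurd (key j i h') (not_le.2 h)
  · intro h
    refine Finset.sum_lt_sum_of_subset (i := i) (fun k hk => ?_) (by simpa using h) (by simp)
      (T.len_pos i) fun k _ _ => (T.len_pos k).le
    simp only [Finset.mem_filter, Finset.mem_univ, true_and] at hk ⊢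
    exact hk.trans h

/-- The number of intervals, the permutation and the lengths are determined by the
transformation. -/
theorem toPerm_injective : Function.Injective toPerm := by
  intro S T h
  have hn := le_antisymm (n_le_of_toPerm_eq S T h) (n_le_of_toPerm_eq T S h.symm)
  have hs := sum_lt_eq_of_toPerm_eq S T h
  have hl1 := len_le_of_toPerm_eq S T h
  have hl2 := len_le_of_toPerm_eq T S h.symm
  have hpS := S.toPerm_leftPt
  have hpT := T.toPerm_leftPt
  have hiS := S.sum_perm_lt_iff
  have hiT := T.sum_perm_lt_iff
  have hlp : ∀ (k : ℕ) (hS : k < S.n) (hT : k < T.n), S.leftPt ⟨k, hS⟩ = T.leftPt ⟨k, hT⟩ :=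
    fun k hS hT => Subtype.ext (hs k hS hT)
  have hlt : ∀ (hn : S.n = T.n) (i j : Fin S.n), S.perm i < S.perm j ↔
      T.perm (Fin.cast hn i) < T.perm (Fin.cast hn j) := by
    intro hn i j
    rw [← hiS, ← hiT, ← hpS, ← hpS, ← hpT, ← hpT, h]
    simp only [Fin.cast]
    rw [← hlp _ i.2, ← hlp _ j.2]
  clear hpS hpT hiS hiT hlp
  obtain ⟨f, n, σ, l, _, _, _, _⟩ := S
  obtain ⟨g, m, τ, l', _, _, _, _⟩ := T
  dsimp only at *
  subst h hn
  have hl : l = l' := funext fun i => le_antisymm (hl2 i i (hs i i.2 i.2).symm)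
    (hl1 i i (hs i i.2 i.2))
  subst hl
  have hσ : σ = τ := by
    have hmono : StrictMono (σ.symm.trans τ) := by
      intro a b hab
      have := (hlt rfl (σ.symm a) (σ.symm b)).1 (by simpa using hab)
      simpa using this
    have he : (hmono.orderIsoOfSurjective _ (σ.symm.trans τ).surjective) = OrderIso.refl _ :=
      Subsingleton.elim _ _
    ext i
    have := congrArg (fun e => e (σ i)) he
    simp at this
    rw [this]
  subst hσ
  rfl

end IET

/-- The admissible IETs, with the subspace topology. -/
abbrev AdmissibleIET : Type := {T : IET // T.IsAdmissible}

/-! Near any admissible IET there are IETs `T'` with lengths `a j * κ + t * (j - σ j)`, where `κ =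
1/q`, `a j` is an integer and `t` is tiny. For `t = 0` such a map would permute the cells `[m κ, (m
+ 1) κ)`. The direction `j - σ j` adds to every translation a positive drift of order `t`;
admissibility is exactly what makes it at least `t` (`one_le_translation_sub`). The drift survives
small changes of the lengths, so all `T` near `T'` share it.

For such `T` the power `g = T ^ q!` shifts each cell slightly, apart from its margins. Hence `g` and
`S⁻¹ g S` commute away from a `δ`-neighbourhood, modulo `κ`, of a finite set `E` determined by `S`,
and their commutator `u` is supported near `E`. A suitable `T ^ k` drifts this neighbourhood off
itself, so `u` and `T ^ k u T ^ (-k)` have disjoint supports and commute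
(`commute_nestedCommutator`).

This relation fails in `SL₂(ZMod m)` for suitable `m`, whereas generators of a free group of rank
two can be sent to any pair in a finite group (`isEmpty_mulEquiv_freeGroup_of_commute`). -/

/-! ### A relation that cannot hold between two generators of a free group of rank two. -/

/-- If a group generated by `x` and `y` is free of rank two, then `x` and `y` can be mapped to
arbitrary elements of any finite group. -/
theorem exists_monoidHom_of_mulEquiv_freeGroup {G H : Type*} [Group G] [Group H] [Finite H]
    (e : G ≃* FreeGroup (Fin 2)) {x y : G} (hxy : Subgroup.closure {x, y} = ⊤) (a b : H) :
    ∃ φ : G →* H, φ x = a ∧ φ y = b := by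
  -- A homomorphism to `H` is given by its values `f` on the free basis; `F` returns its values on
  -- `x`, `y`. As `x`, `y` generate, `F` is injective, hence surjective by finiteness. That `x`, `y`
  -- form a basis is never needed.
  let F : (Fin 2 → H) → (Fin 2 → H) := fun f =>
    ![FreeGroup.lift f (e x), FreeGroup.lift f (e y)]
  have hF : Function.Injective F := by
    intro f f' hff
    have h0 := congrFun hff 0
    have h1 := congrFun hff 1
    simp only [F, Matrix.cons_val_zero, Matrix.cons_val_one] at h0 h1
    have : (FreeGroup.lift f).comp e.toMonoidHom = (FreeGroup.lift f').comp e.toMonoidHom := by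
      refine MonoidHom.eq_of_eqOn_dense hxy ?_
      rintro z (rfl | rfl)
      · exact h0
      · exact h1
    apply FreeGroup.lift.injective
    ext i
    simpa using DFunLike.congr_fun this (e.symm (FreeGroup.of i))
  obtain ⟨f, hf⟩ := Finite.surjective_of_injective hF ![a, b]
  refine ⟨(FreeGroup.lift f).comp e.toMonoidHom, ?_, ?_⟩
  · simpa [F] using congrFun hf 0
  · simpa [F] using congrFun hf 1

section SL

open Matrix

variable {R : Type*} [CommRing R]

/-- The lower triangular unipotent matrix with entry `r`. -/
def lowerUnipotent (r : R) : SpecialLinearGroup (Fin 2) R :=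
  ⟨!![1, 0; r, 1], by simp [Matrix.det_fin_two]⟩

/-- The rotation by a right angle. -/
def rightAngle : SpecialLinearGroup (Fin 2) R :=
  ⟨!![0, 1; -1, 0], by simp [Matrix.det_fin_two]⟩

theorem coe_lowerUnipotent (r : R) :
    (lowerUnipotent r : Matrix (Fin 2) (Fin 2) R) = !![1, 0; r, 1] := rfl

theorem coe_rightAngle :
    ((rightAngle : SpecialLinearGroup (Fin 2) R) : Matrix (Fin 2) (Fin 2) R) =
      !![0, 1; -1, 0] := rfl

theorem lowerUnipotent_mul (r s : R) :
    lowerUnipotent r * lowerUnipotent s = lowerUnipotent (r + s) := by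
  apply Subtype.ext
  simp [coe_lowerUnipotent]

theorem lowerUnipotent_one_pow (N : ℕ) :
    (lowerUnipotent 1 : SpecialLinearGroup (Fin 2) R) ^ N = lowerUnipotent (N : R) := by
  induction N with
  | zero =>
    apply Subtype.ext
    simp [coe_lowerUnipotent, Matrix.one_fin_two]
  | succ N ih => rw [pow_succ, ih, lowerUnipotent_mul]; simp

/-- The commutator `h⁻¹ g⁻¹ h g` of `g = t ^ N` and `h = s⁻¹ g s`. -/
def nestedCommutator {G : Type*} [Group G] (s t : G) (N : ℕ) : G :=
  (s⁻¹ * t ^ N * s)⁻¹ * (t ^ N)⁻¹ * (s⁻¹ * t ^ N * s) * t ^ N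

theorem map_nestedCommutator {G H : Type*} [Group G] [Group H] (φ : G →* H) (s t : G) (N : ℕ) :
    φ (nestedCommutator s t N) = nestedCommutator (φ s) (φ t) N := by
  simp [nestedCommutator]

theorem coe_nestedCommutator_rightAngle (N : ℕ) :
    ((nestedCommutator rightAngle (lowerUnipotent 1) N : SpecialLinearGroup (Fin 2) R) :
      Matrix (Fin 2) (Fin 2) R) =
      !![1 - (N : R) ^ 2 + (N : R) ^ 4, (N : R) ^ 3; (N : R) ^ 3, 1 + (N : R) ^ 2] := by
  simp only [nestedCommutator, lowerUnipotent_one_pow, Matrix.SpecialLinearGroup.coe_mul,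
    Matrix.SpecialLinearGroup.coe_inv, coe_lowerUnipotent, coe_rightAngle]
  ext i j
  fin_cases i <;> fin_cases j <;> simp [Matrix.adjugate_fin_two] <;> ring

/-- The upper right entries of the two products differ by twice `k` times the square of the entry `N
^ 3` of the nested commutator. -/
theorem eq_zero_of_commute_nestedCommutator (N k : ℕ)
    (h : Commute (nestedCommutator rightAngle (lowerUnipotent 1) N)
      (lowerUnipotent (1 : R) ^ k * nestedCommutator rightAngle (lowerUnipotent 1) N *
        (lowerUnipotent 1 ^ k)⁻¹)) :
    (2 * k * N ^ 6 : R) = 0 := by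
  have h' := congrArg
    (fun A : SpecialLinearGroup (Fin 2) R => (A : Matrix (Fin 2) (Fin 2) R) 0 1) h.eq
  simp only [Matrix.SpecialLinearGroup.coe_mul, Matrix.SpecialLinearGroup.coe_inv, lowerUnipotent_one_pow,
    coe_nestedCommutator_rightAngle, coe_lowerUnipotent] at h'
  simp [Matrix.adjugate_fin_two] at h'
  linear_combination h'

end SL

/-- Two elements satisfying the relation `[u, t ^ k u t ^ (-k)] = 1`, where `u` is the nested
commutator, do not generate a free group of rank two. -/
theorem isEmpty_mulEquiv_freeGroup_of_commute {G : Type*} [Group G] (s t : G) {N k : ℕ}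
    (hN : N ≠ 0) (hk : k ≠ 0)
    (h : Commute (nestedCommutator s t N) (t ^ k * nestedCommutator s t N * (t ^ k)⁻¹)) :
    ¬ Nonempty (Subgroup.closure {s, t} ≃* FreeGroup (Fin 2)) := by
  rintro ⟨e⟩
  let x : Subgroup.closure {s, t} := ⟨s, Subgroup.subset_closure (by simp)⟩
  let y : Subgroup.closure {s, t} := ⟨t, Subgroup.subset_closure (by simp)⟩
  have hxy : Subgroup.closure {x, y} = ⊤ := by
    rw [← Subgroup.closure_closure_coe_preimage]
    congr 1
    ext z
    simp [x, y, Subtype.ext_iff]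
  have hc : Commute (nestedCommutator x y N) (y ^ k * nestedCommutator x y N * (y ^ k)⁻¹) := by
    apply Subtype.ext
    have := map_nestedCommutator (Subgroup.closure {s, t}).subtype x y N
    simp only [Subgroup.subtype_apply] at this
    simpa [this, x, y] using h.eq
  -- Modulo this `m`, the quantity `2 * k * N ^ 6` equals `-1`, while the relation forces it to be
  -- `0`.
  let m := 2 * k * N ^ 6 + 1
  have hm : 1 < m := by
    have : 0 < k * N ^ 6 := by positivity
    grind
  have : Fact (1 < m) := ⟨hm⟩
  have : NeZero m := ⟨by omega⟩
  obtain ⟨φ, hx, hy⟩ := exists_monoidHom_of_mulEquiv_freeGroup e hxy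
    (rightAngle : Matrix.SpecialLinearGroup (Fin 2) (ZMod m)) (lowerUnipotent 1)
  have hc' := hc.map φ
  simp only [map_mul, map_inv, map_pow, map_nestedCommutator, hx, hy] at hc'
  have h0 := eq_zero_of_commute_nestedCommutator N k hc'
  have h1 : ((m : ℕ) : ZMod m) = 0 := ZMod.natCast_self m
  simp only [m] at h1
  push_cast at h1
  rw [h0, zero_add] at h1
  exact one_ne_zero h1

/-! ### Drifting maps: almost periodic powers and disjoint supports. -/

/-- `δ`-separation of `x` from the translates of a set `E` by integer multiples of `κ`. -/
def IsFar (κ : ℝ) (E : Finset ℝ) (δ : ℝ) (x : ℝ) : Prop :=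
  ∀ e ∈ E, ∀ m : ℤ, δ ≤ |x - e - m * κ|

/-- Modulo `κ`, the map `T` moves every point to the right by an amount between `a` and `b`. -/
def DriftsMod (κ a b : ℝ) (T : Equiv.Perm (Set.Ico (0 : ℝ) 1)) : Prop :=
  ∀ x, ∃ p : ℤ, a ≤ (T x : ℝ) - x - p * κ ∧ (T x : ℝ) - x - p * κ ≤ b

/-- The map `T` is a translation on each interval `[m κ + b, (m + 1) κ - b]`. -/
def TranslatesCells (κ b : ℝ) (T : Equiv.Perm (Set.Ico (0 : ℝ) 1)) : Prop :=
  ∀ (m : ℤ) (x y : Set.Ico (0 : ℝ) 1), m * κ + b ≤ x → (x : ℝ) ≤ (m + 1) * κ - b →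
    m * κ + b ≤ y → (y : ℝ) ≤ (m + 1) * κ - b → (T x : ℝ) - x = T y - y

section Drift

variable {κ a b : ℝ} {T : Equiv.Perm (Set.Ico (0 : ℝ) 1)}

theorem DriftsMod.pow (h : DriftsMod κ a b T) (k : ℕ) : DriftsMod κ (k * a) (k * b) (T ^ k) := by
  induction k with
  | zero => exact fun x => ⟨0, by simp⟩
  | succ k ih =>
    intro x
    obtain ⟨p, hp, hp'⟩ := ih x
    obtain ⟨p', h1, h2⟩ := h ((T ^ k) x)
    refine ⟨p + p', ?_⟩
    rw [pow_succ', Equiv.Perm.mul_apply, Nat.cast_succ, Int.cast_add]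
    constructor <;> linarith

/-- Finitely many points of a circle of length `κ` are uniformly separated. -/
theorem exists_gap (hκ : 0 < κ) (E : Finset ℝ) :
    ∃ γ > 0, ∀ e ∈ E, ∀ e' ∈ E, ∀ m : ℤ, 0 < e' - e - m * κ → γ ≤ e' - e - m * κ := by
  have key : ∀ r : ℝ, ∃ γ > 0, ∀ m : ℤ, 0 < r - m * κ → γ ≤ r - m * κ := by
    intro r
    -- The least positive element of `r - κ ℤ`.
    refine ⟨r - (⌈r / κ⌉ - 1) * κ, ?_, fun m hm => ?_⟩
    · have := Int.ceil_lt_add_one (r / κ)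
      have : (⌈r / κ⌉ - 1 : ℝ) * κ < r / κ * κ := by gcongr; linarith
      rw [div_mul_cancel₀ _ hκ.ne'] at this
      linarith
    · have h1 : (m : ℝ) < r / κ := by rw [lt_div_iff₀ hκ]; linarith
      have h2 : m < ⌈r / κ⌉ := Int.lt_ceil.2 h1
      have h3 : (m : ℝ) ≤ ⌈r / κ⌉ - 1 := by exact_mod_cast Int.le_sub_one_of_lt h2
      have := mul_le_mul_of_nonneg_right h3 hκ.le
      linarith
  choose γ hγ0 hγ using key
  have : ∀ᶠ c in nhdsWithin (0 : ℝ) (Set.Ioi 0),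
      ∀ e ∈ E, ∀ e' ∈ E, c ≤ γ (e' - e) := by
    simp only [Filter.eventually_all_finset]
    intro e _ e' _
    filter_upwards [Ioo_mem_nhdsGT (hγ0 (e' - e))] with c hc using hc.2.le
  obtain ⟨c, hc, hc0⟩ := (this.and self_mem_nhdsWithin).exists
  exact ⟨c, hc0, fun e he e' he' m hm => (hc e he e' he').trans (hγ _ m hm)⟩

/-- A drifting map moves points close to `E` modulo `κ` to points far from `E` modulo `κ`. -/
theorem DriftsMod.isFar_or_isFar (h : DriftsMod κ a b T) {E : Finset ℝ} {γ δ : ℝ}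
    (hγ : ∀ e ∈ E, ∀ e' ∈ E, ∀ m : ℤ, 0 < e' - e - m * κ → γ ≤ e' - e - m * κ)
    (ha : 2 * δ ≤ a) (hb : b + 2 * δ ≤ γ) (x : Set.Ico (0 : ℝ) 1) :
    IsFar κ E δ x ∨ IsFar κ E δ (T x) := by
  by_contra! hcon
  simp only [IsFar, not_forall, not_le] at hcon
  obtain ⟨⟨e, he, m, hm⟩, e', he', m', hm'⟩ := hcon
  obtain ⟨p, h1, h2⟩ := h x
  rw [abs_lt] at hm hm'
  -- If both points were near `E`, this difference would lie strictly between `a - 2 * δ ≥ 0` and `b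
  -- + 2 * δ ≤ γ`, inside the gap.
  have h3 := hγ e he e' he' (p + m - m') (by push_cast; linarith)
  push_cast at h3
  linarith

/-- A drifting map which translates cells induces a permutation of the cells. -/
theorem exists_perm_cells {q : ℕ} (hq : q * κ = 1) (ha : 0 ≤ a) (hb : 4 * b < κ)
    (hT : DriftsMod κ a b T) (hT' : TranslatesCells κ b T) :
    ∃ (f : Equiv.Perm (Fin q)) (η : Fin q → ℝ), (∀ m, a ≤ η m ∧ η m ≤ b) ∧
      ∀ (m : Fin q) (x : Set.Ico (0 : ℝ) 1), (m : ℝ) * κ + b ≤ x → (x : ℝ) ≤ (m + 1) * κ - b →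
        (T x : ℝ) = x + (f m - m) * κ + η m := by
  have key : ∀ m : Fin q, ∃ (j : Fin q) (c : ℝ), (a ≤ c ∧ c ≤ b) ∧
      ∀ x : Set.Ico (0 : ℝ) 1, (m : ℝ) * κ + b ≤ x → (x : ℝ) ≤ (m + 1) * κ - b →
        (T x : ℝ) = x + (j - m) * κ + c := by
    intro m
    have hm : ((m : ℕ) : ℝ) + 1 ≤ q := by exact_mod_cast m.2
    have hκ : 0 < κ := by
      have : (0 : ℝ) < q := by have : (0 : ℝ) ≤ (m : ℕ) := by positivity
                               linarith
      by_contra! h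
      nlinarith
    have hx0 : (0 : ℝ) ≤ (m + 1 / 2) * κ := by positivity
    have hx1 : (m + 1 / 2 : ℝ) * κ < 1 := by rw [← hq]; gcongr; linarith
    -- The target cell and the shift are read off at the midpoint; `hT'` extends them to the trimmed
    -- cell.
    obtain ⟨p, hp, hp'⟩ := hT ⟨(m + 1 / 2) * κ, hx0, hx1⟩
    have hy0 := (T ⟨(m + 1 / 2) * κ, hx0, hx1⟩).2.1
    have hy1 := (T ⟨(m + 1 / 2) * κ, hx0, hx1⟩).2.2
    simp only at hp hp'
    have hj0 : (-1 : ℝ) < m + p := by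
      by_contra! h
      nlinarith
    have hj1 : (m + p : ℝ) < q := by
      by_contra! h
      nlinarith
    have hj0' : (-1 : ℤ) < m + p := by exact_mod_cast hj0
    have hj1' : (m + p : ℤ) < q := by exact_mod_cast hj1
    obtain ⟨j, hj⟩ := Int.eq_ofNat_of_zero_le (show (0 : ℤ) ≤ m + p by omega)
    have hjr : (j : ℝ) = m + p := by exact_mod_cast hj.symm
    refine ⟨⟨j, by omega⟩, _, ⟨hp, hp'⟩, fun x hx hx' => ?_⟩
    have := hT' m x ⟨(m + 1 / 2) * κ, hx0, hx1⟩ (by simpa using hx) (by simpa using hx')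
      (by push_cast; linarith) (by push_cast; linarith)
    simp only at this ⊢
    rw [hjr]
    linarith
  choose f η hη hf using key
  have hinj : Function.Injective f := by
    intro m m' hmm
    have hm : ((m : ℕ) : ℝ) + 1 ≤ q := by exact_mod_cast m.2
    have hm' : ((m' : ℕ) : ℝ) + 1 ≤ q := by exact_mod_cast m'.2
    have hκ : 0 < κ := by have := hη m; linarith
    have h1 := mul_le_mul_of_nonneg_right hm hκ.le
    have h2 := mul_le_mul_of_nonneg_right hm' hκ.le
    have h3 : 0 ≤ (m : ℝ) * κ := by positivity
    have h4 : 0 ≤ (m' : ℝ) * κ := by positivity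
    have e1 := hη m
    have e2 := hη m'
    -- The point of cell `m` that `T` sends to the midpoint of cell `f m`. If `f m = f m'`,
    -- injectivity of `T` identifies the two such points, so the cells coincide.
    let x : Set.Ico (0 : ℝ) 1 := ⟨(m + 1 / 2) * κ - η m, by constructor <;> linarith⟩
    let x' : Set.Ico (0 : ℝ) 1 := ⟨(m' + 1 / 2) * κ - η m', by constructor <;> linarith⟩
    have hx := hf m x (by simp only [x]; linarith) (by simp only [x]; linarith)
    have hx' := hf m' x' (by simp only [x']; linarith) (by simp only [x']; linarith)
    have hxx : x = x' := by
      apply T.injective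
      apply Subtype.ext
      rw [hx, hx', hmm]
      simp only [x, x']
      ring
    have hxx' : (m + 1 / 2) * κ - η m = (m' + 1 / 2) * κ - η m' := congrArg Subtype.val hxx
    have l1 : (m : ℝ) < m' + 1 := by
      by_contra! h
      nlinarith
    have l2 : (m' : ℝ) < m + 1 := by
      by_contra! h
      nlinarith
    have l1' : (m : ℕ) < m' + 1 := by exact_mod_cast l1
    have l2' : (m' : ℕ) < m + 1 := by exact_mod_cast l2
    ext
    omega
  exact ⟨Equiv.ofBijective f hinj.bijective_of_finite, η, hη, hf⟩

/-- A suitable power of a drifting map translates each cell by a small amount. -/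
theorem exists_pow_translation {q : ℕ} (hq : q * κ = 1) (ha : 0 ≤ a) (hb : 4 * b < κ)
    (hT : DriftsMod κ a b T) (hT' : TranslatesCells κ b T) :
    ∃ c : Fin q → ℝ, (∀ m, 0 ≤ c m ∧ c m ≤ q.factorial * b) ∧
      ∀ (m : Fin q) (x : Set.Ico (0 : ℝ) 1), (m : ℝ) * κ + (q.factorial + 1) * b ≤ x →
        (x : ℝ) ≤ (m + 1) * κ - (q.factorial + 1) * b →
        ((T ^ q.factorial) x : ℝ) = x + c m := by
  obtain ⟨f, η, hη, hf⟩ := exists_perm_cells hq ha hb hT hT'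
  -- All shifts lie in `[0, b]`: the right margin grows by `b` at each iteration, while the left
  -- margin can stay `b`.
  have key : ∀ j : ℕ, ∃ c : Fin q → ℝ, (∀ m, 0 ≤ c m ∧ c m ≤ j * b) ∧
      ∀ (m : Fin q) (x : Set.Ico (0 : ℝ) 1), (m : ℝ) * κ + b ≤ x →
        (x : ℝ) ≤ (m + 1) * κ - (j + 1) * b →
        ((T ^ j) x : ℝ) = x + ((f ^ j) m - m) * κ + c m := by
    intro j
    induction j with
    | zero => exact ⟨0, by simp, by simp⟩
    | succ j ih =>
      obtain ⟨c, hc, hcT⟩ := ih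
      refine ⟨fun m => η m + c (f m), fun m => ?_, fun m x hx hx' => ?_⟩
      · have := hc (f m)
        have := hη m
        push_cast
        constructor <;> linarith
      · have hm := hη m
        have hjb : 0 ≤ (j : ℝ) * b := (hc m).1.trans (hc m).2
        push_cast at hx'
        have h1 := hf m x hx (by linarith)
        have h2 := hcT (f m) (T x) (by rw [h1]; linarith) (by rw [h1]; linarith)
        rw [pow_succ, pow_succ, Equiv.Perm.mul_apply, Equiv.Perm.mul_apply, h2, h1]
        ring
  obtain ⟨c, hc, hcT⟩ := key q.factorial
  refine ⟨c, hc, fun m x hx hx' => ?_⟩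
  have hm := hη m
  have : f ^ q.factorial = 1 := by
    have := pow_card_eq_one' (x := f)
    rwa [Nat.card_eq_fintype_card, Fintype.card_perm, Fintype.card_fin] at this
  rw [hcT m x ?_ hx', this]
  · simp
  · have : 0 ≤ (q.factorial : ℝ) * b := (hc m).1.trans (hc m).2
    linarith

theorem exists_cell_of_far {q : ℕ} (hq : q * κ = 1) {δ : ℝ} (hδ : 0 < δ) {x : Set.Ico (0 : ℝ) 1}
    (hx : ∀ m : ℤ, δ ≤ |(x : ℝ) - m * κ|) :
    ∃ m : Fin q, (m : ℝ) * κ + δ ≤ x ∧ (x : ℝ) ≤ (m + 1) * κ - δ := by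
  have hκ : 0 < κ := by
    have : (0 : ℝ) ≤ q := by positivity
    by_contra! h
    nlinarith
  have h1 := Int.floor_le ((x : ℝ) / κ)
  have h2 := Int.lt_floor_add_one ((x : ℝ) / κ)
  rw [le_div_iff₀ hκ] at h1
  rw [div_lt_iff₀ hκ] at h2
  have h3 : 0 ≤ ⌊(x : ℝ) / κ⌋ := Int.floor_nonneg.2 (div_nonneg x.2.1 hκ.le)
  obtain ⟨m, hm⟩ := Int.eq_ofNat_of_zero_le h3
  have e1 := hx m
  have e2 := hx (m + 1)
  rw [hm] at h1 h2
  push_cast at h1 h2 e1 e2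
  rw [abs_of_nonneg (by linarith)] at e1
  rw [abs_of_nonpos (by linarith)] at e2
  have hmq : (m : ℝ) < q := by
    by_contra! h
    have := x.2.2
    nlinarith
  exact ⟨⟨m, by exact_mod_cast hmq⟩, by simp only; linarith, by simp only; linarith⟩

/-- Two small piecewise translations `g` and `S⁻¹ g S` commute at points away from the
discontinuities. -/
theorem commute_apply_of_isFar {q : ℕ} (hq : q * κ = 1) {g S : Equiv.Perm (Set.Ico (0 : ℝ) 1)}
    {c : Fin q → ℝ} {C : ℝ} (hC : 0 < C) (hc : ∀ m, 0 ≤ c m ∧ c m ≤ C)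
    (hg : ∀ (m : Fin q) (x : Set.Ico (0 : ℝ) 1), (m : ℝ) * κ + C ≤ x →
        (x : ℝ) ≤ (m + 1) * κ - C → (g x : ℝ) = x + c m)
    {z : Set.Ico (0 : ℝ) 1} (hz : ∀ m : ℤ, 3 * C ≤ |(z : ℝ) - m * κ|)
    (hSz : ∀ m : ℤ, 3 * C ≤ |(S z : ℝ) - m * κ|)
    (hS : ∀ y : Set.Ico (0 : ℝ) 1, (z : ℝ) ≤ y → (y : ℝ) < z + 3 * C → (S y : ℝ) - y = S z - z) :
    g ((S⁻¹ * g * S) z) = (S⁻¹ * g * S) (g z) := by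
  obtain ⟨m, hm, hm'⟩ := exists_cell_of_far hq (by linarith) hz
  obtain ⟨j, hj, hj'⟩ := exists_cell_of_far hq (by linarith) hSz
  have cm := hc m
  have cj := hc j
  have hlt : (z : ℝ) + 3 * C ≤ 1 := by
    have h1 : ((m : ℕ) : ℝ) + 1 ≤ q := by exact_mod_cast m.2
    have hκ : 0 ≤ κ := by
      have : (0 : ℝ) ≤ q := by positivity
      by_contra! h
      nlinarith
    have := mul_le_mul_of_nonneg_right h1 hκ
    linarith
  have hgz := hg m z (by linarith) (by linarith)
  -- Near `z`, the map `S` is a translation into cell `j`, so the conjugate is the shift by `c j`.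
  -- The room `3 * C` accommodates both shifts and the margin `C`.
  have h : ∀ y : Set.Ico (0 : ℝ) 1, (z : ℝ) ≤ y → (y : ℝ) ≤ z + C →
      ((S⁻¹ * g * S) y : ℝ) = y + c j := by
    intro y hy hy'
    have hSy := hS y hy (by linarith)
    let w : Set.Ico (0 : ℝ) 1 := ⟨y + c j, by have := y.2.1; constructor <;> linarith⟩
    have hSw := hS w (by simp only [w]; linarith) (by simp only [w]; linarith)
    have : g (S y) = S w := by
      apply Subtype.ext
      rw [hg j (S y) (by linarith) (by linarith)]
      simp only [w] at hSw ⊢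
      linarith
    rw [Equiv.Perm.mul_apply, Equiv.Perm.mul_apply, this, Equiv.Perm.inv_def, Equiv.symm_apply_apply]
  apply Subtype.ext
  have hz' := h z le_rfl (by linarith)
  rw [h (g z) (by linarith) (by linarith), hgz, hg m _ (by linarith) (by linarith), hz']
  ring

/-- If `T` is a drifting map which translates cells, and `S` is a piecewise translation, then `S`
and `T` satisfy a nontrivial relation. -/
theorem commute_nestedCommutator {q : ℕ} (hq : q * κ = 1) (ha : 0 ≤ a) (hb0 : 0 < b)
    (hb : 4 * b < κ) (hT : DriftsMod κ a b T) (hT' : TranslatesCells κ b T)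
    {S : Equiv.Perm (Set.Ico (0 : ℝ) 1)} {E : Finset ℝ} {γ δ : ℝ} (h0 : 0 ∈ E)
    (hES : ∀ z : Set.Ico (0 : ℝ) 1, (z : ℝ) - S z ∈ E)
    (hS : ∀ z : Set.Ico (0 : ℝ) 1, ∃ e ∈ E, (z : ℝ) < e ∧ ∀ y : Set.Ico (0 : ℝ) 1,
      (z : ℝ) ≤ y → (y : ℝ) < e → (S y : ℝ) - y = S z - z)
    (hγ : ∀ e ∈ E, ∀ e' ∈ E, ∀ m : ℤ, 0 < e' - e - m * κ → γ ≤ e' - e - m * κ)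
    {k : ℕ} (hδ : δ = 3 * ((q.factorial + 1) * b)) (hka : 2 * δ ≤ k * a)
    (hkb : k * b + 2 * δ ≤ γ) :
    Commute (nestedCommutator S T q.factorial)
      (T ^ k * nestedCommutator S T q.factorial * (T ^ k)⁻¹) := by
  obtain ⟨c, hc, hcT⟩ := exists_pow_translation hq ha hb hT hT'
  -- Distance from three kinds of elements of `E` is used: `0` keeps `z` off the cell boundaries, `z
  -- - S z` does so for `S z`, and the `e` from `hS` (with `m = 0`) keeps `S` a translation just to
  -- the right of `z`.
  have hfix : ∀ z : Set.Ico (0 : ℝ) 1, IsFar κ E δ z → nestedCommutator S T q.factorial z = z := by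
    intro z hz
    have hz0 : ∀ m : ℤ, 3 * ((q.factorial + 1) * b) ≤ |(z : ℝ) - m * κ| := fun m => by
      simpa [hδ] using hz 0 h0 m
    have := commute_apply_of_isFar hq (g := T ^ q.factorial) (S := S) (c := c)
      (C := (q.factorial + 1) * b) (by positivity)
      (fun m => ⟨(hc m).1, (hc m).2.trans (by gcongr; linarith)⟩) hcT hz0
      (fun m => by
        have := hz _ (hES z) m
        rw [hδ] at this
        convert this using 2
        ring)
      (fun y hy hy' => by
        obtain ⟨e, he, hze, h⟩ := hS z
        refine h y hy (hy'.trans_le ?_)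
        have := hz e he 0
        rw [abs_of_nonpos (by push_cast; linarith), hδ] at this
        push_cast at this
        linarith)
    simp only [nestedCommutator]
    rw [Equiv.Perm.mul_apply, Equiv.Perm.mul_apply, Equiv.Perm.mul_apply, ← this,
      Equiv.Perm.inv_def (T ^ _), Equiv.symm_apply_apply, Equiv.Perm.inv_def,
      Equiv.symm_apply_apply]
  refine Equiv.Perm.Disjoint.commute fun z => ?_
  -- If `(T ^ k)⁻¹ z` is far from `E`, the conjugate fixes `z`; otherwise `z` is far and the
  -- commutator itself fixes it.
  rcases (hT.pow k).isFar_or_isFar hγ hka hkb ((T ^ k)⁻¹ z) with h | h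
  · right
    rw [Equiv.Perm.mul_apply, Equiv.Perm.mul_apply, hfix _ h, Equiv.Perm.inv_def, Equiv.apply_symm_apply]
  · left
    rw [Equiv.Perm.inv_def, Equiv.apply_symm_apply] at h
    exact hfix _ h

end Drift

/-! ### Combinatorics of admissible permutations. -/

/-- Among the sets of a given cardinality, initial segments have the smallest sum. -/
theorem sum_Iio_add_card_sdiff_le {n : ℕ} (m : Fin n) (s : Finset (Fin n)) (hs : s.card = m) :
    ∑ j ∈ Finset.Iio m, (j : ℤ) + ((s \ Finset.Iio m).card : ℤ) ≤ ∑ j ∈ s, (j : ℤ) := by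
  -- As many elements enter as leave; those entering are at least `m`, those leaving at most `m -
  -- 1`, so each exchange gains at least one.
  have hcard : (s \ Finset.Iio m).card = (Finset.Iio m \ s).card :=
    Finset.card_sdiff_comm (by simpa using hs)
  have h1 := Finset.sum_inter_add_sum_sdiff s (Finset.Iio m) (fun j : Fin n => (j : ℤ))
  have h2 := Finset.sum_inter_add_sum_sdiff (Finset.Iio m) s (fun j : Fin n => (j : ℤ))
  rw [Finset.inter_comm] at h2
  have h3 : ((s \ Finset.Iio m).card : ℤ) * m ≤ ∑ j ∈ s \ Finset.Iio m, (j : ℤ) := by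
    rw [← nsmul_eq_mul]
    refine Finset.card_nsmul_le_sum _ _ _ fun j hj => ?_
    simp only [Finset.mem_sdiff, Finset.mem_Iio, not_lt, Fin.le_def] at hj
    exact_mod_cast hj.2
  have h4 : ∑ j ∈ Finset.Iio m \ s, (j : ℤ) ≤ ((Finset.Iio m \ s).card : ℤ) * (m - 1) := by
    rw [← nsmul_eq_mul]
    refine Finset.sum_le_card_nsmul _ _ _ fun j hj => ?_
    simp only [Finset.mem_sdiff, Finset.mem_Iio, Fin.lt_def] at hj
    have := hj.1
    omega
  rw [← hcard] at h4
  linarith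

/-- For an admissible permutation, lengthening the `j`-th interval proportionally to `j - σ j`
increases all translation lengths. -/
theorem one_le_translation_sub {n : ℕ} (σ : Equiv.Perm (Fin n))
    (hσ : ¬ ∃ k, σ k = k ∧ σ '' Set.Iic k = Set.Iic k) (i : Fin n) :
    1 ≤ ∑ j with σ j < σ i, ((j : ℤ) - σ j) - ∑ j with j < i, ((j : ℤ) - σ j) := by
  -- The quantity to bound is the excess of the sum over `s` above that over `Iio i`, plus the same
  -- excess for `s'` and `Iio (σ i)`. Both are nonnegative integers; if both vanish, `s` and `s'`
  -- are initial segments, which makes `i` a forbidden index.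
  let s := (Finset.Iio i).map σ.toEmbedding
  let s' := (Finset.Iio (σ i)).map σ.symm.toEmbedding
  have h1 := sum_Iio_add_card_sdiff_le i s (by simp [s])
  have h2 := sum_Iio_add_card_sdiff_le (σ i) s' (by simp [s'])
  have e1 : ∑ j with j < i, ((j : ℤ) - σ j) = ∑ j ∈ Finset.Iio i, (j : ℤ) - ∑ j ∈ s, (j : ℤ) := by
    simp only [s, Finset.sum_map, ← Finset.sum_sub_distrib]
    refine Finset.sum_congr (by ext; simp) fun _ _ => rfl
  have e2 : ∑ j with σ j < σ i, ((j : ℤ) - σ j) =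
      ∑ j ∈ s', (j : ℤ) - ∑ j ∈ Finset.Iio (σ i), (j : ℤ) := by
    have hs' : Finset.univ.filter (fun j => σ j < σ i) = s' := by
      ext j
      simp only [s', Finset.mem_filter, Finset.mem_univ, true_and, Finset.mem_map_equiv,
        Finset.mem_Iio, Equiv.symm_symm]
    rw [hs', Finset.sum_sub_distrib]
    simp [s', Finset.sum_map]
  by_contra! hlt
  have c1 : (s \ Finset.Iio i).card = 0 := by omega
  have c2 : (s' \ Finset.Iio (σ i)).card = 0 := by omega
  rw [Finset.card_eq_zero, Finset.sdiff_eq_empty_iff_subset] at c1 c2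
  have d1 : s = Finset.Iio i := Finset.eq_of_subset_of_card_le c1 (by simp [s])
  have d2 : s' = Finset.Iio (σ i) := Finset.eq_of_subset_of_card_le c2 (by simp [s'])
  have hfix : σ i = i := by
    apply le_antisymm
    · by_contra! h
      have : i ∈ s' := by rw [d2]; simpa using h
      simp [s'] at this
    · by_contra! h
      have : σ i ∈ s := by rw [d1]; simpa using h
      simp [s] at this
  refine hσ ⟨i, hfix, ?_⟩
  have d1' : σ '' Set.Iio i = Set.Iio i := by
    have := congrArg (fun t : Finset (Fin n) => (t : Set (Fin n))) d1
    simpa [s] using this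
  rw [← Set.Iio_insert, Set.image_insert_eq, d1', hfix]

/-! ### Interval exchanges with prescribed lengths and permutation. -/

section Construction

variable {n : ℕ} {l : Fin n → ℝ}

theorem exists_partialSum_le_lt (hl : ∑ i, l i = 1) {x : ℝ} (hx : x ∈ Set.Ico (0 : ℝ) 1) :
    ∃ i, ∑ j with j < i, l j ≤ x ∧ x < ∑ j with j < i, l j + l i := by
  classical
  let P : ℕ → ℝ := fun k => ∑ j ∈ Finset.univ.filter (fun j : Fin n => (j : ℕ) < k), l j
  have hP : ∃ k, x < P k := ⟨n, by simpa [P, hl] using hx.2⟩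
  have hk := Nat.find_spec hP
  obtain ⟨k, hk'⟩ : ∃ k, Nat.find hP = k + 1 := by
    refine Nat.exists_eq_succ_of_ne_zero fun h0 => ?_
    rw [h0] at hk
    simp [P] at hk
    exact absurd hx.1 (not_le.2 hk)
  have hmin : P k ≤ x := by
    by_contra! h
    have := Nat.find_min' hP h
    omega
  rw [hk'] at hk
  have hkn : k < n := by
    by_contra! h
    have : P (k + 1) = P k := by
      simp only [P]
      congr 1
      ext j
      simp only [Finset.mem_filter, Finset.mem_univ, true_and]
      omega
    linarith
  refine ⟨⟨k, hkn⟩, hmin, hk.trans_eq ?_⟩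
  rw [add_comm (∑ j with _, l j), ← Finset.sum_insert (by simp)]
  refine Finset.sum_congr ?_ fun _ _ => rfl
  ext j
  simp only [Finset.mem_filter, Finset.mem_insert, Finset.mem_univ, true_and, Fin.lt_def,
    Fin.ext_iff]
  omega

theorem exists_permutedPartialSum_le_lt (σ : Equiv.Perm (Fin n)) (hl : ∑ i, l i = 1) {x : ℝ}
    (hx : x ∈ Set.Ico (0 : ℝ) 1) :
    ∃ i, ∑ j with σ j < σ i, l j ≤ x ∧ x < ∑ j with σ j < σ i, l j + l i := by
  obtain ⟨m, hm⟩ := exists_partialSum_le_lt (l := l ∘ σ.symm)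
    (by rw [← hl]; exact Equiv.sum_comp σ.symm l) hx
  refine ⟨σ.symm m, ?_⟩
  have : ∑ j with σ j < σ (σ.symm m), l j = ∑ j with j < m, (l ∘ σ.symm) j := by
    rw [Finset.sum_filter, Finset.sum_filter, ← Equiv.sum_comp σ.symm]
    simp
  rw [this]
  exact hm

theorem permutedPartialSum_add_le (σ : Equiv.Perm (Fin n)) (h0 : ∀ i, 0 < l i) {i i' : Fin n}
    (h : σ i < σ i') : ∑ j with σ j < σ i, l j + l i ≤ ∑ j with σ j < σ i', l j := by
  rw [add_comm, ← Finset.sum_insert (by simp)]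
  refine Finset.sum_le_sum_of_subset_of_nonneg (fun k hk => ?_) fun k _ _ => (h0 k).le
  simp only [Finset.mem_filter, Finset.mem_insert, Finset.mem_univ, true_and] at hk ⊢
  rcases hk with rfl | hk
  · exact h
  · exact hk.trans h

theorem permutedPartialSum_add_le_one (σ : Equiv.Perm (Fin n)) (h0 : ∀ i, 0 < l i)
    (hl : ∑ i, l i = 1) (i : Fin n) : ∑ j with σ j < σ i, l j + l i ≤ 1 := by
  rw [add_comm, ← Finset.sum_insert (by simp), ← hl]
  exact Finset.sum_le_sum_of_subset_of_nonneg (Finset.subset_univ _) fun k _ _ => (h0 k).le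

theorem eq_of_permutedPartialSum_le_lt (σ : Equiv.Perm (Fin n)) (h0 : ∀ i, 0 < l i) {x : ℝ}
    {i i' : Fin n} (h1 : ∑ j with σ j < σ i, l j ≤ x) (h2 : x < ∑ j with σ j < σ i, l j + l i)
    (h1' : ∑ j with σ j < σ i', l j ≤ x) (h2' : x < ∑ j with σ j < σ i', l j + l i') :
    i = i' := by
  apply σ.injective
  rcases lt_trichotomy (σ i) (σ i') with h | h | h
  · have := permutedPartialSum_add_le σ h0 h
    linarith
  · exact h
  · have := permutedPartialSum_add_le σ h0 h
    linarith

/-- The map `f` exchanges intervals with lengths `l` according to the permutation `σ`. -/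
def IsExchange (f : Equiv.Perm (Set.Ico (0 : ℝ) 1)) (σ : Equiv.Perm (Fin n)) (l : Fin n → ℝ) :
    Prop :=
  ∀ (i : Fin n) (x : Set.Ico (0 : ℝ) 1),
    (∑ j with j < i, l j) ≤ (x : ℝ) → (x : ℝ) < (∑ j with j < i, l j) + l i →
      (f x : ℝ) = x + ((∑ j with σ j < σ i, l j) - (∑ j with j < i, l j))

/-- The source intervals and the image intervals each partition `[0,1)`, so the piecewise
translation is bijective. This supplies the transformation when the lengths of an IET are perturbed.
-/
theorem exists_isExchange (σ : Equiv.Perm (Fin n)) (h0 : ∀ i, 0 < l i) (hl : ∑ i, l i = 1) :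
    ∃ f, IsExchange f σ l := by
  choose ι hι hι' using fun x : Set.Ico (0 : ℝ) 1 => exists_partialSum_le_lt hl x.2
  have hB : ∀ i, 0 ≤ ∑ j with σ j < σ i, l j := fun i => Finset.sum_nonneg fun j _ => (h0 j).le
  let F : Set.Ico (0 : ℝ) 1 → Set.Ico (0 : ℝ) 1 := fun x =>
    ⟨x + ((∑ j with σ j < σ (ι x), l j) - (∑ j with j < ι x, l j)), by
      have := hι x
      have := hι' x
      have := hB (ι x)
      have := permutedPartialSum_add_le_one σ h0 hl (ι x)
      constructor <;> linarith⟩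
  have hι_eq : ∀ (x : Set.Ico (0 : ℝ) 1) (i : Fin n), ∑ j with j < i, l j ≤ x →
      (x : ℝ) < ∑ j with j < i, l j + l i → ι x = i := fun x i h1 h2 =>
    eq_of_permutedPartialSum_le_lt 1 h0 (hι x) (hι' x) h1 h2
  have hF : Function.Bijective F := by
    constructor
    · intro x y hxy
      have hxy' : (x : ℝ) + ((∑ j with σ j < σ (ι x), l j) - (∑ j with j < ι x, l j)) =
        y + ((∑ j with σ j < σ (ι y), l j) - (∑ j with j < ι y, l j)) := congrArg Subtype.val hxy
      have h1 := hι x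
      have h2 := hι' x
      have h3 := hι y
      have h4 := hι' y
      have : ι x = ι y := eq_of_permutedPartialSum_le_lt σ h0
        (x := x + ((∑ j with σ j < σ (ι x), l j) - (∑ j with j < ι x, l j)))
        (by linarith) (by linarith) (by linarith) (by linarith)
      rw [this] at hxy'
      exact Subtype.ext (by linarith)
    · intro y
      obtain ⟨i, hi, hi'⟩ := exists_permutedPartialSum_le_lt σ hl y.2
      have h1 : 0 ≤ ∑ j with j < i, l j := Finset.sum_nonneg fun j _ => (h0 j).le
      have h2 : ∑ j with j < i, l j + l i ≤ 1 := permutedPartialSum_add_le_one 1 h0 hl i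
      let x : Set.Ico (0 : ℝ) 1 :=
        ⟨y - ((∑ j with σ j < σ i, l j) - (∑ j with j < i, l j)), by constructor <;> linarith⟩
      have hx : ι x = i := hι_eq x i (by simp only [x]; linarith) (by simp only [x]; linarith)
      refine ⟨x, Subtype.ext ?_⟩
      simp only [F, hx]
      simp only [x]
      ring
  refine ⟨Equiv.ofBijective F hF, fun i x h1 h2 => ?_⟩
  simp only [Equiv.ofBijective_apply, F, hι_eq x i h1 h2]

end Construction

namespace IET

theorem isExchange (T : IET) : IsExchange T.toPerm T.perm T.len := T.toPerm_apply

/-- The IET with the same underlying permutation as `T` and with lengths `l`. -/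
noncomputable def withLengths (T : IET) (l : Fin T.n → ℝ) (h0 : ∀ i, 0 < l i)
    (hl : ∑ i, l i = 1) : IET where
  toPerm := (exists_isExchange T.perm h0 hl).choose
  n := T.n
  perm := T.perm
  len := l
  len_pos := h0
  len_sum := hl
  reduced := T.reduced
  toPerm_apply := (exists_isExchange T.perm h0 hl).choose_spec

theorem samePerm_withLengths (T : IET) (l : Fin T.n → ℝ) (h0 : ∀ i, 0 < l i)
    (hl : ∑ i, l i = 1) : SamePerm T (T.withLengths l h0 hl) :=
  ⟨rfl, fun _ => rfl⟩

theorem edist_withLengths (T : IET) (l : Fin T.n → ℝ) (h0 : ∀ i, 0 < l i)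
    (hl : ∑ i, l i = 1) :
    edist T (T.withLengths l h0 hl) = ENNReal.ofReal (∑ i, |T.len i - l i|) :=
  edist_def _ _ (T.samePerm_withLengths l h0 hl)

theorem exists_isExchange_of_edist_lt {S T : IET} {r : ℝ} (h : edist S T < ENNReal.ofReal r) :
    ∃ l : Fin S.n → ℝ, (∀ i, 0 < l i) ∧ ∑ i, l i = 1 ∧ IsExchange T.toPerm S.perm l ∧
      ∑ i, |S.len i - l i| < r := by
  by_cases hST : SamePerm S T
  · rw [edist_def S T hST, ENNReal.ofReal_lt_ofReal_iff_of_nonneg (by positivity)] at h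
    have hT := T.isExchange
    obtain ⟨_, n, σ, l, _, _, _, _⟩ := S
    obtain ⟨_, m, τ, l', h0, hl, _, _⟩ := T
    obtain ⟨hn, hp⟩ := hST
    dsimp only at hn hp h hT ⊢
    subst hn
    have hσ : σ = τ := Equiv.ext hp
    subst hσ
    exact ⟨l', h0, hl, hT, h⟩
  · rw [edist_eq_top S T hST] at h
    simp at h

end IET

/-! ### Rational approximation and the drift of perturbed lengths. -/

theorem abs_sum_finset_le {ι : Type*} [Fintype ι] (s : Finset ι) (f : ι → ℝ) :
    |∑ j ∈ s, f j| ≤ ∑ j, |f j| :=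
  (Finset.abs_sum_le_sum_abs _ _).trans
    (Finset.sum_le_sum_of_subset_of_nonneg (Finset.subset_univ s) fun _ _ _ => abs_nonneg _)

/-- A probability vector can be approximated by vectors with a common denominator. -/
theorem exists_rational_approx {n : ℕ} {l : Fin n → ℝ} (hl : ∑ i, l i = 1) {r : ℝ} (hr : 0 < r) :
    ∃ (q : ℕ) (a : Fin n → ℤ), 0 < q ∧ ∑ i, a i = q ∧ ∑ i, |l i - a i * (q : ℝ)⁻¹| < r := by
  have hn : n ≠ 0 := by
    rintro rfl
    simp at hl
  have hn' : (0 : ℝ) < n := by positivity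
  obtain ⟨q, hq⟩ := exists_nat_gt (2 * n / r)
  have hq0 : (0 : ℝ) < q := lt_of_le_of_lt (by positivity) hq
  let i₀ : Fin n := ⟨0, by omega⟩
  -- Rounding all `q * l i` down loses `R`, an integer between `0` and `n`; entry `i₀` absorbs it,
  -- for a total error of at most `2 * n / q`.
  let R : ℤ := q - ∑ i, ⌊q * l i⌋
  have hR : (R : ℝ) = ∑ i, Int.fract (q * l i) := by
    simp only [R, Int.fract, Finset.sum_sub_distrib, ← Finset.mul_sum, hl]
    push_cast
    ring
  have hR0 : 0 ≤ (R : ℝ) := by rw [hR]; exact Finset.sum_nonneg fun i _ => Int.fract_nonneg _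
  have hRn : (R : ℝ) ≤ n := by
    rw [hR]
    calc ∑ i, Int.fract (q * l i) ≤ ∑ i : Fin n, (1 : ℝ) :=
          Finset.sum_le_sum fun i _ => (Int.fract_lt_one _).le
      _ = n := by simp
  refine ⟨q, fun i => ⌊q * l i⌋ + if i = i₀ then R else 0, by exact_mod_cast hq0, ?_, ?_⟩
  · rw [Finset.sum_add_distrib]
    simp [R]
  · have key : ∀ i, |l i - ((⌊q * l i⌋ + if i = i₀ then R else 0 : ℤ) : ℝ) * (q : ℝ)⁻¹| ≤
        (q : ℝ)⁻¹ * (Int.fract (q * l i) + if i = i₀ then (R : ℝ) else 0) := by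
      intro i
      have : l i - ((⌊q * l i⌋ + if i = i₀ then R else 0 : ℤ) : ℝ) * (q : ℝ)⁻¹ =
          (q : ℝ)⁻¹ * (Int.fract (q * l i) - if i = i₀ then (R : ℝ) else 0) := by
        simp only [Int.fract]
        push_cast
        field_simp
        ring
      rw [this, abs_mul, abs_of_pos (inv_pos.2 hq0)]
      gcongr
      refine (abs_sub _ _).trans ?_
      rw [abs_of_nonneg (Int.fract_nonneg _), abs_of_nonneg]
      split_ifs <;> simp [hR0]
    calc _ ≤ ∑ i, (q : ℝ)⁻¹ * (Int.fract (q * l i) + if i = i₀ then (R : ℝ) else 0) :=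
          Finset.sum_le_sum fun i _ => key i
      _ = (q : ℝ)⁻¹ * (R + R) := by
          rw [← Finset.mul_sum, Finset.sum_add_distrib, ← hR]
          simp
      _ ≤ (q : ℝ)⁻¹ * (2 * n) := by gcongr; linarith
      _ < r := by
          rw [div_lt_iff₀ hr] at hq
          rw [inv_mul_lt_iff₀ hq0]
          exact hq

section Exchange

variable {n : ℕ} {f : Equiv.Perm (Set.Ico (0 : ℝ) 1)} {σ : Equiv.Perm (Fin n)} {l : Fin n → ℝ}

theorem IsExchange.driftsMod (hf : IsExchange f σ l) (hl : ∑ i, l i = 1) {κ a b : ℝ}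
    (h : ∀ i, ∃ p : ℤ, a ≤ ∑ j with σ j < σ i, l j - ∑ j with j < i, l j - p * κ ∧
      ∑ j with σ j < σ i, l j - ∑ j with j < i, l j - p * κ ≤ b) : DriftsMod κ a b f := by
  intro x
  obtain ⟨i, hi, hi'⟩ := exists_partialSum_le_lt hl x.2
  obtain ⟨p, hp⟩ := h i
  refine ⟨p, ?_⟩
  rw [hf i x hi hi']
  convert hp using 2 <;> ring

/-- Since all end points are within `b` of `κ ℤ`, an exchanged interval meeting a trimmed cell
contains all of it. -/
theorem IsExchange.translatesCells (hf : IsExchange f σ l) (hl : ∑ i, l i = 1) {κ b : ℝ}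
    (hκ : 0 < κ)
    (h : ∀ i, ∃ p : ℤ, |∑ j with j < i, l j - p * κ| < b)
    (h' : ∀ i, ∃ p : ℤ, |∑ j with j < i, l j + l i - p * κ| < b) : TranslatesCells κ b f := by
  intro m x y hx hx' hy hy'
  obtain ⟨i, hi, hi'⟩ := exists_partialSum_le_lt hl x.2
  obtain ⟨p, hp⟩ := h i
  obtain ⟨p', hp'⟩ := h' i
  rw [abs_lt] at hp hp'
  have h1 : (p : ℝ) * κ < (m + 1) * κ := by linarith
  have h2 : (m : ℝ) * κ < p' * κ := by linarith
  have h1' : p < m + 1 := by exact_mod_cast lt_of_mul_lt_mul_right h1 hκ.le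
  have h2' : m < p' := by exact_mod_cast lt_of_mul_lt_mul_right h2 hκ.le
  have h3 : (p : ℝ) ≤ m := by exact_mod_cast Int.lt_add_one_iff.1 h1'
  have h4 : (m + 1 : ℝ) ≤ p' := by exact_mod_cast h2'
  have h3' := mul_le_mul_of_nonneg_right h3 hκ.le
  have h4' := mul_le_mul_of_nonneg_right h4 hκ.le
  rw [hf i x hi hi', hf i y (by linarith) (by linarith)]
  ring

/-- Splitting a sum of lengths into its rational part, its drift and an error term. -/
theorem sum_perturbation (s : Finset (Fin n)) (a c : Fin n → ℤ) (κ t : ℝ)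
    (l : Fin n → ℝ) :
    ∑ j ∈ s, l j = ((∑ j ∈ s, a j : ℤ) : ℝ) * κ + t * ((∑ j ∈ s, c j : ℤ) : ℝ) +
      ∑ j ∈ s, (l j - (a j * κ + t * c j)) := by
  push_cast
  rw [Finset.sum_mul, Finset.mul_sum, ← Finset.sum_add_distrib, ← Finset.sum_add_distrib]
  exact Finset.sum_congr rfl fun j _ => by ring

/-- Perturbing rational lengths in the direction `j - σ j` produces a drift. -/
theorem IsExchange.drifts_and_translates (hf : IsExchange f σ l) (hl : ∑ i, l i = 1)
    (hσ : ¬ ∃ k, σ k = k ∧ σ '' Set.Iic k = Set.Iic k) {κ t C : ℝ} (hκ : 0 < κ) (ht : 0 < t)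
    (a : Fin n → ℤ) (hC : C = ∑ j : Fin n, |(((j : ℤ) - σ j : ℤ) : ℝ)|)
    (h : ∑ j, |l j - (a j * κ + t * ((j : ℤ) - σ j : ℤ))| < t / 4) :
    DriftsMod κ (t / 2) ((2 * C + 1) * t) f ∧ TranslatesCells κ ((2 * C + 1) * t) f := by
  have hsum := fun s : Finset (Fin n) =>
    sum_perturbation s a (fun j => (j : ℤ) - σ j) κ t l
  have hsmall : ∀ s : Finset (Fin n),
      |∑ j ∈ s, (l j - (a j * κ + t * ((j : ℤ) - σ j : ℤ)))| < t / 4 := fun s =>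
    (abs_sum_finset_le s _).trans_lt h
  have hc : ∀ s : Finset (Fin n), |((∑ j ∈ s, ((j : ℤ) - σ j) : ℤ) : ℝ)| ≤ C := fun s => by
    rw [hC, Int.cast_sum]
    exact abs_sum_finset_le s _
  have hclose : ∀ s : Finset (Fin n), ∃ p : ℤ, |∑ j ∈ s, l j - p * κ| < (2 * C + 1) * t := by
    intro s
    refine ⟨∑ j ∈ s, a j, ?_⟩
    have h1 := hsmall s
    have h2 := abs_le.1 (hc s)
    rw [abs_lt] at h1
    have h3 := mul_le_mul_of_nonneg_left h2.1 ht.le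
    have h4 := mul_le_mul_of_nonneg_left h2.2 ht.le
    have h5 : 0 ≤ C * t := mul_nonneg ((abs_nonneg _).trans (hc s)) ht.le
    rw [hsum s, abs_lt]
    constructor <;> linarith
  constructor
  · refine hf.driftsMod hl fun i => ?_
    -- Modulo `κ` there remain a drift between `t` and `2 * C * t` and two errors below `t / 4`.
    refine ⟨∑ j with σ j < σ i, a j - ∑ j with j < i, a j, ?_⟩
    have h1 := hsmall {j | σ j < σ i}
    have h2 := hsmall {j | j < i}
    have h3 := abs_le.1 (hc {j | σ j < σ i})
    have h4 := abs_le.1 (hc {j | j < i})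
    have h5 : (1 : ℝ) ≤ ((∑ j with σ j < σ i, ((j : ℤ) - σ j) : ℤ) : ℝ) -
        ((∑ j with j < i, ((j : ℤ) - σ j) : ℤ) : ℝ) := by
      exact_mod_cast one_le_translation_sub σ hσ i
    rw [abs_lt] at h1 h2
    rw [hsum {j | σ j < σ i}, hsum {j | j < i}, Int.cast_sub]
    have e1 := mul_le_mul_of_nonneg_left h5 ht.le
    have e2 := mul_le_mul_of_nonneg_left h3.2 ht.le
    have e3 := mul_le_mul_of_nonneg_left h4.1 ht.le
    constructor <;> linarith
  · refine hf.translatesCells hl hκ (fun i => hclose _) fun i => ?_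
    have := hclose (insert i (Finset.univ.filter fun j => j < i))
    rwa [Finset.sum_insert (by simp), add_comm] at this

end Exchange

/-! ### Singularities of `S`, choice of constants and density. -/

namespace IET

/-- The right end points and the opposites of the translation lengths of an IET, and `0`. -/
noncomputable def singularities (S : IET) : Finset ℝ :=
  insert 0 (Finset.univ.image (fun i => ∑ j with j < i, S.len j + S.len i) ∪
    Finset.univ.image (fun i => ∑ j with j < i, S.len j - ∑ j with S.perm j < S.perm i, S.len j))

theorem sub_toPerm_mem_singularities (S : IET) (z : Set.Ico (0 : ℝ) 1) :
    (z : ℝ) - S.toPerm z ∈ S.singularities := by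
  obtain ⟨i, hi, hi'⟩ := exists_partialSum_le_lt S.len_sum z.2
  refine Finset.mem_insert_of_mem (Finset.mem_union_right _ (Finset.mem_image.2 ⟨i, by simp, ?_⟩))
  rw [S.toPerm_apply i z hi hi']
  ring

theorem exists_singularity_gt (S : IET) (z : Set.Ico (0 : ℝ) 1) :
    ∃ e ∈ S.singularities, (z : ℝ) < e ∧ ∀ y : Set.Ico (0 : ℝ) 1, (z : ℝ) ≤ y → (y : ℝ) < e →
      (S.toPerm y : ℝ) - y = S.toPerm z - z := by
  obtain ⟨i, hi, hi'⟩ := exists_partialSum_le_lt S.len_sum z.2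
  refine ⟨_, Finset.mem_insert_of_mem (Finset.mem_union_left _ (Finset.mem_image.2
    ⟨i, by simp, rfl⟩)), hi', fun y hy hy' => ?_⟩
  rw [S.toPerm_apply i z hi hi', S.toPerm_apply i y (hi.trans hy) hy']
  ring

/-- Arbitrarily close to an admissible IET there is one all of whose neighbours satisfy a
nontrivial relation with `S`. -/
theorem exists_edist_lt_forall_not_free (S T : IET) (hT : T.IsAdmissible) {r : ℝ} (hr : 0 < r) :
    ∃ T' : IET, T'.IsAdmissible ∧ edist T T' < ENNReal.ofReal r ∧ ∃ ρ > 0, ∀ T'' : IET,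
      edist T' T'' < ENNReal.ofReal ρ →
        ¬ Nonempty (Subgroup.closure {S.toPerm, T''.toPerm} ≃* FreeGroup (Fin 2)) := by
  obtain ⟨μ, hμ0, hμ⟩ : ∃ μ > 0, ∀ i, μ ≤ T.len i := by
    have : ∀ᶠ μ in nhdsWithin (0 : ℝ) (Set.Ioi 0), ∀ i, μ ≤ T.len i := by
      rw [Filter.eventually_all]
      intro i
      filter_upwards [Ioo_mem_nhdsGT (T.len_pos i)] with c hc using hc.2.le
    obtain ⟨μ, hμ, hμ0⟩ := (this.and self_mem_nhdsWithin).exists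
    exact ⟨μ, hμ0, hμ⟩
  obtain ⟨q, a, hq0, ha, hqa⟩ :=
    exists_rational_approx T.len_sum (r := min r μ / 2) (by positivity)
  have hq0' : (0 : ℝ) < q := by exact_mod_cast hq0
  have hκ : 0 < (q : ℝ)⁻¹ := inv_pos.2 hq0'
  have hqκ : (q : ℝ) * (q : ℝ)⁻¹ = 1 := mul_inv_cancel₀ hq0'.ne'
  generalize (q : ℝ)⁻¹ = κ at *
  -- These entries sum to `0`, so moving in this direction preserves the total length.
  let c : Fin T.n → ℤ := fun j => (j : ℤ) - T.perm j
  have hc_sum : ∑ j, c j = 0 := by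
    simp only [c, Finset.sum_sub_distrib]
    rw [Equiv.sum_comp T.perm (fun j => ((j : ℕ) : ℤ)), sub_self]
  obtain ⟨C, hC⟩ : ∃ C, C = ∑ j, |(c j : ℝ)| := ⟨_, rfl⟩
  have hC0 : 0 ≤ C := hC ▸ Finset.sum_nonneg fun _ _ => abs_nonneg _
  obtain ⟨γ, hγ0, hγ⟩ := exists_gap hκ S.singularities
  -- Exactly what `2 * δ ≤ k * (t / 2)` requires for `δ = 3 * ((q! + 1) * ((2 * C + 1) * t))`. Both
  -- sides are linear in `t`, so `k` is independent of `t`, which can then be taken small relative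
  -- to `k` and `γ`.
  obtain ⟨k, hk⟩ := exists_nat_ge (12 * ((q.factorial + 1) * (2 * C + 1)))
  have hk0 : k ≠ 0 := by
    rintro rfl
    have : 0 < 12 * ((q.factorial + 1) * (2 * C + 1)) := by positivity
    norm_num at hk
    linarith
  obtain ⟨t, ht0, ht1, ht2, ht3⟩ : ∃ t > 0, t * C < min r μ / 2 ∧
      4 * ((2 * C + 1) * t) < κ ∧
      k * ((2 * C + 1) * t) + 2 * (3 * ((q.factorial + 1) * ((2 * C + 1) * t))) ≤ γ := by
    have h1 : ∀ A B : ℝ, 0 < B → ∀ᶠ t in nhdsWithin (0 : ℝ) (Set.Ioi 0), A * t < B := by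
      intro A B hB
      have : Filter.Tendsto (fun t : ℝ => A * t) (nhds 0) (nhds (A * 0)) :=
        (continuous_const.mul continuous_id).tendsto 0
      rw [mul_zero] at this
      exact (this.eventually_lt_const hB).filter_mono nhdsWithin_le_nhds
    obtain ⟨t, ⟨⟨h2, h3⟩, h4⟩, h5⟩ := (((h1 C (min r μ / 2) (by positivity)).and
      (h1 (4 * (2 * C + 1)) κ hκ)).and
      (h1 (k * (2 * C + 1) + 2 * (3 * ((q.factorial + 1) * (2 * C + 1)))) γ hγ0)).and
      self_mem_nhdsWithin |>.exists
    exact ⟨t, h5, by linarith, by linarith, by linarith⟩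
  let l : Fin T.n → ℝ := fun j => a j * κ + t * c j
  have hdist : ∑ j, |T.len j - l j| < min r μ := by
    calc ∑ j, |T.len j - l j| ≤ ∑ j, (|T.len j - a j * κ| + t * |(c j : ℝ)|) := by
          refine Finset.sum_le_sum fun j _ => ?_
          have : T.len j - l j = (T.len j - a j * κ) - t * c j := by simp only [l]; ring
          rw [this]
          refine (abs_sub _ _).trans ?_
          rw [abs_mul, abs_of_pos ht0]
      _ < min r μ := by
          rw [Finset.sum_add_distrib, ← Finset.mul_sum, ← hC]
          linarith
  have hl0 : ∀ i, 0 < l i := by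
    intro i
    have h1 : |T.len i - l i| < μ :=
      (Finset.single_le_sum (f := fun j => |T.len j - l j|) (fun _ _ => abs_nonneg _)
        (Finset.mem_univ i)).trans_lt (hdist.trans_le (min_le_right _ _))
    have h2 := hμ i
    rw [abs_lt] at h1
    linarith
  have hl1 : ∑ i, l i = 1 := by
    simp only [l, Finset.sum_add_distrib, ← Finset.sum_mul, ← Finset.mul_sum]
    rw [← Int.cast_sum, ← Int.cast_sum, ha, hc_sum]
    simpa using hqκ
  refine ⟨T.withLengths l hl0 hl1, hT, ?_, t / 4, by positivity, fun T'' hT'' => ?_⟩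
  · rw [edist_withLengths, ENNReal.ofReal_lt_ofReal_iff hr]
    exact hdist.trans_le (min_le_left _ _)
  · obtain ⟨l', -, hl', hex, hlt⟩ := exists_isExchange_of_edist_lt hT''
    obtain ⟨hd, hc⟩ := hex.drifts_and_translates hl' hT hκ ht0 a hC (by
      refine lt_of_eq_of_lt (Finset.sum_congr rfl fun j _ => ?_) hlt
      rw [abs_sub_comm]
      rfl)
    refine isEmpty_mulEquiv_freeGroup_of_commute _ _ q.factorial_ne_zero hk0
      (commute_nestedCommutator hqκ (by positivity) (by positivity) ht2 hd hc
        (Finset.mem_insert_self _ _) S.sub_toPerm_mem_singularities S.exists_singularity_gt hγ rfl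
        ?_ ht3)
    have := mul_le_mul_of_nonneg_right hk ht0.le
    linarith

end IET

theorem theorem1 (S : IET) :
    ∃ Ω : Set AdmissibleIET, IsOpen Ω ∧ Dense Ω ∧
      ∀ T ∈ Ω, ¬ Nonempty (Subgroup.closure {S.toPerm, T.1.toPerm} ≃* FreeGroup (Fin 2)) := by
  -- Openness is automatic for the interior; its density is `IET.exists_edist_lt_forall_not_free`,
  -- which provides a whole ball around `T'`.
  refine ⟨interior {T | ¬ Nonempty
    (Subgroup.closure {S.toPerm, T.1.toPerm} ≃* FreeGroup (Fin 2))}, isOpen_interior, fun T => ?_,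
    fun T hT => interior_subset hT⟩
  rw [EMetric.mem_closure_iff]
  intro ε hε
  obtain ⟨r, hr0, hr⟩ := ENNReal.lt_iff_exists_nnreal_btwn.1 hε
  obtain ⟨T', hT', hd, ρ, hρ, h⟩ :=
    IET.exists_edist_lt_forall_not_free S T.1 T.2 (r := r) (by exact_mod_cast hr0)
  rw [ENNReal.ofReal_coe_nnreal] at hd
  refine ⟨⟨T', hT'⟩, ?_, hd.trans hr⟩
  rw [mem_interior_iff_mem_nhds, EMetric.mem_nhds_iff]
  refine ⟨ENNReal.ofReal ρ, by simpa using hρ, fun T'' hT'' => h T''.1 ?_⟩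
  rw [edist_comm]
  exact hT''
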